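/- **Definitions.** An integer linear inequality in $x_1,\dots,x_N$ is $\sum_i a_i x_i\ge b$ with $a_i,b\in\mathbb Z$. A set of such inequalities is *unsatisfiable* if no $0/1$ assignment satisfies all of them; it *defines a feasible LP* if some point of $\mathbb R^N$ satisfies all of them. An *unsatisfiable family* $\mathscr F=\{\mathcal F_n\}_{n\in\mathbb N}$ consists of unsatisfiable sets $\mathcal F_n$ of integer linear inequalities, $\mathcal F_n$ being over $\nu(n)\ge n$ variables. A *Stabbing Planes (SP) refutation* of $\mathcal F$ is a finite binary tree. Each inner node is labelled with a query $(\mathbf a,b)$, $\mathbf a\in\mathbb Z^N$, $b\in\mathbb Z$, its two outgoing edges being labelled $\mathbf a\mathbf x\ge b$ and $\mathbf a\mathbf x\le b-1$. Each leaf is labelled with an infeasible (over $\mathbb R$) system of linear inequalities, each of which is a nonnegative linear combination of inequalities from $\mathcal F$ and of the inequalities labelling the path from the root to that leaf. Its *length* is the number of queries (inner nodes). Let $W\subseteq[0,1]\cap\mathbb Q$ be a finite set with $0\in W$ and $k=|W|\ge 2$. A word $s\in W^{\nu(n)}$ is *admissible* for $\mathcal F_n$ if it satisfies all inequalities of $\mathcal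 F_n$; $\mathcal A(\mathcal F_n,W)$ is the set of admissible words. $\mathscr F$ is *almost full* (with respect to $W$) if $|\mathcal A(\mathcal F_n,W)|\ge k^{\nu(n)}-o(k^{\nu(n)})$ as $n\to\infty$. A restriction $\rho$ is a $0/1$ assignment to a set of variables; $\mathcal F{\restriction}_\rho$ is obtained from $\mathcal F$ by substituting the values of $\rho$. For $c>0$, $\mathscr F$ is *$c$-self-reducible* if for every $n$ and every set $V$ of $v<n/c$ variables of $\mathcal F_n$ the number $n-cv$ is a natural number and there is a restriction $\rho$ with domain $V'\supseteq V$ such that $\mathcal F_n{\restriction}_\rho=\mathcal F_{n-cv}$ up to a renaming of the variables (a bijection between the variables of $\mathcal F_n$ outside $V'$ and those of $\mathcal F_{n-cv}$), where inequalities that hold at every point of the cube $[0,1]^{\nu(n-cv)}$ are disregarded on both sides. **Theorem.** Let $W$ be as above, let $c>0$, and let $\mathscr F=\{\mathcal F_n\}_{n\in\mathbb N}$ be an unsatisfiable family that is almost full with respect to $W$ and $c$-self-reducible, and suppose that $\mathcal F_n$ defines a feasible LP for all sufficiently large $n$. Then there are a constant $C>0$ and an $n_0$ such that for all $n\ge n_0$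 every SP refutation of $\mathcal F_n$ has length at least $C\,n^{1/4}$. -/

import Mathlib

namespace StabbingPlanes

/-- The linear inequality `∑ i, coeff i * x i ≥ rhs` in the variables `x i`, `i : ι`. -/
@[ext]
structure LinIneq (R : Type) (ι : Type) where
  coeff : ι → R
  rhs : R

namespace LinIneq

/-- An integer linear inequality, seen as an inequality with real coefficients. -/
def toReal {ι : Type} (f : LinIneq ℤ ι) : LinIneq ℝ ι where
  coeff := fun i => (f.coeff i : ℝ)
  rhs := (f.rhs : ℝ)

/-- The real point `x` satisfies the inequality. -/
def Holds {ι : Type} [Fintype ι] (p : LinIneq ℝ ι) (x : ι → ℝ) : Prop :=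
  p.rhs ≤ ∑ i, p.coeff i * x i

/-- Renaming of variables along a bijection. -/
def rename {ι κ : Type} (e : ι ≃ κ) (f : LinIneq ℤ ι) : LinIneq ℤ κ where
  coeff := fun k => f.coeff (e.symm k)
  rhs := f.rhs

/-- An inequality is trivial if it holds at every point of the cube `[0,1]^ι`, that is, if it
carries no information about variables taking values between `0` and `1`. -/
def Trivial {ι : Type} [Fintype ι] (f : LinIneq ℤ ι) : Prop :=
  ∀ x : ι → ℝ, (∀ i, 0 ≤ x i ∧ x i ≤ 1) → f.toReal.Holds x

end LinIneq

/-- The point `x` satisfies every inequality of the set `F` of integer linear inequalities. -/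
def Satisfies {ι : Type} [Fintype ι] (x : ι → ℝ) (F : Set (LinIneq ℤ ι)) : Prop :=
  ∀ f ∈ F, f.toReal.Holds x

/-- A system of real linear inequalities (a linear program) is feasible if some real point
satisfies all of them. -/
def Feasible {ι : Type} [Fintype ι] (P : Set (LinIneq ℝ ι)) : Prop :=
  ∃ x : ι → ℝ, ∀ p ∈ P, p.Holds x

/-- A set of integer linear inequalities is unsatisfiable if no `0/1` assignment satisfies all
of its members. -/
def Unsatisfiable {ι : Type} [Fintype ι] (F : Set (LinIneq ℤ ι)) : Prop :=
  ¬ ∃ x : ι → ℝ, (∀ i, x i = 0 ∨ x i = 1) ∧ Satisfies x F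

/-! ### Stabbing Planes -/

/-- `p` is a nonnegative linear combination of finitely many inequalities of `F`. -/
def IsNonnegComb {ι : Type} (F : Set (LinIneq ℤ ι)) (p : LinIneq ℝ ι) : Prop :=
  ∃ w : LinIneq ℤ ι →₀ ℝ, (∀ f, 0 ≤ w f) ∧ (∀ f ∈ w.support, f ∈ F) ∧
    (∀ i, p.coeff i = ∑ f ∈ w.support, w f * (f.coeff i : ℝ)) ∧
    p.rhs = ∑ f ∈ w.support, w f * (f.rhs : ℝ)

/-- Binary trees whose inner nodes are labelled with queries `(a, b)`, `a` an integer vector and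
`b` an integer, and whose leaves are labelled with linear programs. In `node a b l r` the edge to
`l` is labelled `a x ≥ b`, the edge to `r` is labelled `a x ≤ b - 1`. -/
inductive SPTree (ι : Type) : Type
  | leaf (P : Set (LinIneq ℝ ι)) : SPTree ι
  | node (a : ι → ℤ) (b : ℤ) (l r : SPTree ι) : SPTree ι

namespace SPTree

/-- The tree is a Stabbing Planes proof of `F`: the linear program at each leaf consists of
nonnegative linear combinations of inequalities from `F` and of the inequalities on the path from
the root to that leaf. The recursion adds the labels of the path to `F`. -/
def IsProof {ι : Type} : SPTree ι → Set (LinIneq ℤ ι) → Prop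
  | leaf P, F => ∀ p ∈ P, IsNonnegComb F p
  | node a b l r, F =>
      l.IsProof (insert ⟨a, b⟩ F) ∧ r.IsProof (insert ⟨-a, -(b - 1)⟩ F)

/-- The linear programs at all leaves are infeasible. -/
def LeavesInfeasible {ι : Type} [Fintype ι] : SPTree ι → Prop
  | leaf P => ¬ Feasible P
  | node _ _ l r => l.LeavesInfeasible ∧ r.LeavesInfeasible

/-- The tree is a Stabbing Planes refutation of `F`. -/
def IsRefutation {ι : Type} [Fintype ι] (T : SPTree ι) (F : Set (LinIneq ℤ ι)) : Prop :=
  T.IsProof F ∧ T.LeavesInfeasible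

/-- The length of a tree: the number of its queries. -/
def length {ι : Type} : SPTree ι → ℕ
  | leaf _ => 0
  | node _ _ l r => l.length + r.length + 1

end SPTree

/-! ### Restrictions -/

/-- A restriction: a `0/1` assignment (`true` is `1`, `false` is `0`) to the variables in a set
`dom`. -/
structure Restriction (ι : Type) where
  dom : Finset ι
  val : {i // i ∈ dom} → Bool

/-- The inequality in the variables outside `ρ.dom` that results from `f` by setting the variables
in `ρ.dom` according to `ρ`. -/
def LinIneq.restrict {ι : Type} (f : LinIneq ℤ ι) (ρ : Restriction ι) :
    LinIneq ℤ {i // i ∉ ρ.dom} where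
  coeff := fun i => f.coeff i
  rhs := f.rhs - ∑ i, f.coeff i.1 * (if ρ.val i then 1 else 0)

/-- `F` and `G` are the same set of inequalities up to the renaming `e` of variables, where
inequalities that hold on the whole cube `[0,1]^κ` are disregarded. -/
def SameUpToRenaming {ι κ : Type} [Fintype κ] (e : ι ≃ κ)
    (F : Set (LinIneq ℤ ι)) (G : Set (LinIneq ℤ κ)) : Prop :=
  {f | f ∈ LinIneq.rename e '' F ∧ ¬ f.Trivial} = {g | g ∈ G ∧ ¬ g.Trivial}

/-! ### Families -/

/-- An unsatisfiable family `F₀, F₁, F₂, …`: the set `F n` of integer linear inequalities is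
unsatisfiable and has `ν n ≥ n` variables. -/
structure UnsatFamily where
  ν : ℕ → ℕ
  le_ν : ∀ n, n ≤ ν n
  F : (n : ℕ) → Set (LinIneq ℤ (Fin (ν n)))
  unsat : ∀ n, Unsatisfiable (F n)

/-- The set of admissible words for `F`: the words over the alphabet `W`, one letter for each
variable, that satisfy every inequality of `F`. -/
def admissible {ι : Type} [Fintype ι] (F : Set (LinIneq ℤ ι)) (W : Finset ℚ) :
    Set (ι → {q // q ∈ W}) :=
  {s | Satisfies (fun i => ((s i : ℚ) : ℝ)) F}

/-- The family is almost full with respect to `W`: with `k = |W|`, the number of admissible words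
for the `n`-th set is `k ^ ν(n) - o(k ^ ν(n))` as `n → ∞`. -/
def AlmostFull (𝓕 : UnsatFamily) (W : Finset ℚ) : Prop :=
  (fun n : ℕ => (W.card : ℝ) ^ 𝓕.ν n - ((admissible (𝓕.F n) W).ncard : ℝ))
    =o[Filter.atTop] (fun n : ℕ => (W.card : ℝ) ^ 𝓕.ν n)

/-- The family is `c`-self-reducible: for any set `V` of `v < n / c` variables of the `n`-th set,
some restriction with domain containing `V` turns the `n`-th set into the `(n - c v)`-th set, up
to renaming of variables. (In particular `n - c v` is a natural number.) -/
def SelfReducible (𝓕 : UnsatFamily) (c : ℝ) : Prop :=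
  ∀ (n : ℕ) (V : Finset (Fin (𝓕.ν n))), (V.card : ℝ) < n / c →
    ∃ m : ℕ, (m : ℝ) = n - c * V.card ∧
      ∃ ρ : Restriction (Fin (𝓕.ν n)), V ⊆ ρ.dom ∧
        ∃ e : {i // i ∉ ρ.dom} ≃ Fin (𝓕.ν m),
          SameUpToRenaming e ((fun f => f.restrict ρ) '' 𝓕.F n) (𝓕.F m)

end StabbingPlanes

/-!
Call the open strip `b - 1 < a x < b` that a query removes its slab. A solution of the system that
avoids all slabs of a refutation would satisfy the labels along some branch, and so the infeasible
linear program at its leaf; hence the slabs of the queries cover all solutions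
(`SPTree.exists_inSlab`).

A query with many variables has a thin slab. If `2h` variables occur in it, then at most a fraction
`K / √(2h + 1)` of all words over `W` lies in its slab, where `K` depends only on the gaps between
letters of `W` (`LinIneq.card_inSlab_le`). This is a Littlewood–Offord bound, deduced from Sperner's
theorem by averaging over the ways to move some of the letters of a word by a fixed-point-free
permutation of `W`.

A query with few variables is removed by setting them: its value becomes an integer, so no point
that agrees with the restriction lies in its slab. Self-reducibility turns the rest
into a cover of the solutions of a member of the family with a smaller index. Repeating this with the threshold `2h`, `h = ⌊√n⌋`, a refutation with `t`
queries of the `n`-th set gives a cover by at most `t` slabs of wide queries for the `m`-th set,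
where `m ≥ n - 2cht` (`SelfReducible.exists_wide_slabCover`). If `t < C n ^ (1 / 4)` with `C` small,
then `m ≥ n / 2`, so for large `n` at least half of all words are admissible for the `m`-th set,
while these slabs contain at most a quarter of them.
-/

namespace StabbingPlanes

open Finset

/-! ### Slabs of queries -/

/-- The point `x` lies in the open slab `b - 1 < a x < b` that the query `(a, b)` removes; the query
is encoded as the inequality `a x ≥ b`. -/
def LinIneq.InSlab {ι : Type} [Fintype ι] (q : LinIneq ℤ ι) (x : ι → ℝ) : Prop :=
  (q.rhs : ℝ) - 1 < ∑ i, (q.coeff i : ℝ) * x i ∧ ∑ i, (q.coeff i : ℝ) * x i < q.rhs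

/-- The variables that occur in an inequality. -/
def LinIneq.support {ι : Type} [Fintype ι] (q : LinIneq ℤ ι) : Finset ι :=
  univ.filter fun i => q.coeff i ≠ 0

/-- The queries `(a, b)` of a tree, encoded as the inequalities `a x ≥ b`. -/
def SPTree.queries {ι : Type} : SPTree ι → List (LinIneq ℤ ι)
  | leaf _ => []
  | node a b l r => ⟨a, b⟩ :: (l.queries ++ r.queries)

theorem SPTree.length_queries {ι : Type} (T : SPTree ι) : T.queries.length = T.length := by
  induction T with
  | leaf P => rfl
  | node a b l r hl hr => simp [queries, length, hl, hr]

theorem IsNonnegComb.holds {ι : Type} [Fintype ι] {F : Set (LinIneq ℤ ι)} {p : LinIneq ℝ ι}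
    (hp : IsNonnegComb F p) {x : ι → ℝ} (hx : Satisfies x F) : p.Holds x := by
  obtain ⟨w, hw, hF, hc, hr⟩ := hp
  unfold LinIneq.Holds
  calc p.rhs = ∑ f ∈ w.support, w f * (f.rhs : ℝ) := hr
    _ ≤ ∑ f ∈ w.support, w f * ∑ i, (f.coeff i : ℝ) * x i :=
        sum_le_sum fun f hf => mul_le_mul_of_nonneg_left (hx f (hF f hf)) (hw f)
    _ = ∑ i, p.coeff i * x i := by
        simp only [hc, mul_sum, sum_mul]
        rw [sum_comm]
        simp only [mul_assoc]

/-- A solution of the system that avoids all slabs could follow the labels of a branch down to a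
leaf, whose linear program it would solve. -/
theorem SPTree.exists_inSlab {ι : Type} [Fintype ι] (T : SPTree ι) :
    ∀ {F : Set (LinIneq ℤ ι)}, T.IsRefutation F → ∀ {x : ι → ℝ}, Satisfies x F →
      ∃ q ∈ T.queries, q.InSlab x := by
  induction T with
  | leaf P =>
    intro F hT x hx
    exact absurd ⟨x, fun p hp => (hT.1 p hp).holds hx⟩ hT.2
  | node a b l r hl hr =>
    intro F hT x hx
    obtain ⟨⟨hpl, hpr⟩, hil, hir⟩ := hT
    by_cases h₁ : (b : ℝ) ≤ ∑ i, (a i : ℝ) * x i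
    · have hx' : Satisfies x (insert ⟨a, b⟩ F) := by
        rintro f (rfl | hf)
        · exact h₁
        · exact hx f hf
      obtain ⟨q, hq, hs⟩ := hl ⟨hpl, hil⟩ hx'
      exact ⟨q, by simp [queries, hq], hs⟩
    · by_cases h₂ : ∑ i, (a i : ℝ) * x i ≤ (b : ℝ) - 1
      · have hx' : Satisfies x (insert ⟨-a, -(b - 1)⟩ F) := by
          rintro f (rfl | hf)
          · simp only [LinIneq.Holds, LinIneq.toReal, Pi.neg_apply, Int.cast_neg, neg_mul,
              sum_neg_distrib, Int.cast_sub, Int.cast_one]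
            linarith
          · exact hx f hf
        obtain ⟨q, hq, hs⟩ := hr ⟨hpr, hir⟩ hx'
        exact ⟨q, by simp [queries, hq], hs⟩
      · exact ⟨⟨a, b⟩, by simp [queries], not_le.1 h₂, not_le.1 h₁⟩

/-! ### Restrictions and points -/

/-- The value, `0` or `1`, that a restriction gives to a variable of its domain. -/
def Restriction.bit {ι : Type} (ρ : Restriction ι) (i : {i // i ∈ ρ.dom}) : ℤ :=
  if ρ.val i then 1 else 0

/-- The point that agrees with `ρ` on its domain and with `x`, renamed along `e`, elsewhere. -/
def Restriction.extend {ι κ : Type} [DecidableEq ι] (ρ : Restriction ι)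
    (e : {i // i ∉ ρ.dom} ≃ κ) (x : κ → ℝ) (i : ι) : ℝ :=
  if h : i ∈ ρ.dom then (ρ.bit ⟨i, h⟩ : ℝ) else x (e ⟨i, h⟩)

theorem Restriction.extend_mem_cube {ι κ : Type} [DecidableEq ι] (ρ : Restriction ι)
    (e : {i // i ∉ ρ.dom} ≃ κ) {x : κ → ℝ} (hx : ∀ k, 0 ≤ x k ∧ x k ≤ 1) (i : ι) :
    0 ≤ ρ.extend e x i ∧ ρ.extend e x i ≤ 1 := by
  unfold extend bit
  split_ifs
  · simp
  · simp
  · exact hx _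

theorem LinIneq.sum_extend {ι κ : Type} [Fintype ι] [Fintype κ] [DecidableEq ι]
    (f : LinIneq ℤ ι) (ρ : Restriction ι) (e : {i // i ∉ ρ.dom} ≃ κ) (x : κ → ℝ) :
    ∑ i, (f.coeff i : ℝ) * ρ.extend e x i =
      ∑ k, (((f.restrict ρ).rename e).coeff k : ℝ) * x k +
        ((f.rhs : ℝ) - (((f.restrict ρ).rename e).rhs : ℝ)) := by
  rw [← Fintype.sum_subtype_add_sum_subtype (fun i => i ∈ ρ.dom), add_comm]
  congr 1
  · rw [← e.sum_comp]
    refine sum_congr rfl fun i _ => ?_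
    simp [Restriction.extend, i.2, rename, restrict]
  · simp only [rename, restrict, Int.cast_sub, Int.cast_sum, Int.cast_mul, sub_sub_cancel]
    refine sum_congr (by ext; simp) fun i _ => ?_
    simp [Restriction.extend, i.2, Restriction.bit]

theorem LinIneq.inSlab_rename_restrict {ι κ : Type} [Fintype ι] [Fintype κ] [DecidableEq ι]
    {q : LinIneq ℤ ι} {ρ : Restriction ι} {e : {i // i ∉ ρ.dom} ≃ κ} {x : κ → ℝ}
    (h : q.InSlab (ρ.extend e x)) : ((q.restrict ρ).rename e).InSlab x := by
  unfold InSlab at *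
  rw [sum_extend] at h
  constructor <;> linarith [h.1, h.2]

/-- A query all of whose variables are set takes an integer value, so its slab is missed. -/
theorem LinIneq.not_inSlab_extend {ι κ : Type} [Fintype ι] [DecidableEq ι]
    {q : LinIneq ℤ ι} {ρ : Restriction ι} (hq : q.support ⊆ ρ.dom)
    (e : {i // i ∉ ρ.dom} ≃ κ) (x : κ → ℝ) : ¬ q.InSlab (ρ.extend e x) := by
  have hsum : ∑ i, (q.coeff i : ℝ) * ρ.extend e x i =
      ((∑ i : {i // i ∈ ρ.dom}, q.coeff i * ρ.bit i : ℤ) : ℝ) := by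
    rw [← Fintype.sum_subtype_add_sum_subtype (fun i => i ∈ ρ.dom), Int.cast_sum]
    have h0 : ∑ i : {i // i ∉ ρ.dom}, (q.coeff i : ℝ) * ρ.extend e x i = 0 := by
      refine sum_eq_zero fun i _ => ?_
      have : q.coeff i = 0 := by
        by_contra h
        exact i.2 (hq (by simp [support, h]))
      simp [this]
    rw [h0, add_zero]
    refine sum_congr (by ext; simp) fun i _ => ?_
    simp [Restriction.extend, i.2]
  rintro ⟨h₁, h₂⟩
  rw [hsum] at h₁ h₂
  have h₁' : q.rhs - 1 < ∑ i : {i // i ∈ ρ.dom}, q.coeff i * ρ.bit i := by exact_mod_cast h₁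
  have h₂' : ∑ i : {i // i ∈ ρ.dom}, q.coeff i * ρ.bit i < q.rhs := by exact_mod_cast h₂
  omega

/-- Only the cube matters here: inequalities that are disregarded hold on it. -/
theorem SameUpToRenaming.satisfies_extend {ι κ : Type} [Fintype ι] [Fintype κ] [DecidableEq ι]
    {F : Set (LinIneq ℤ ι)} {G : Set (LinIneq ℤ κ)} {ρ : Restriction ι}
    {e : {i // i ∉ ρ.dom} ≃ κ}
    (h : SameUpToRenaming e ((fun f => f.restrict ρ) '' F) G) {x : κ → ℝ}
    (hx : ∀ k, 0 ≤ x k ∧ x k ≤ 1) (hG : Satisfies x G) : Satisfies (ρ.extend e x) F := by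
  intro f hf
  have key : ((f.restrict ρ).rename e).toReal.Holds x := by
    by_cases ht : ((f.restrict ρ).rename e).Trivial
    · exact ht x hx
    · have hmem : (f.restrict ρ).rename e ∈
          {g | g ∈ LinIneq.rename e '' ((fun f => f.restrict ρ) '' F) ∧ ¬ g.Trivial} :=
        ⟨⟨_, ⟨f, hf, rfl⟩, rfl⟩, ht⟩
      rw [h] at hmem
      exact hG _ hmem.1
  have hs := f.sum_extend ρ e x
  simp only [LinIneq.Holds, LinIneq.toReal] at key ⊢
  linarith

/-! ### Removing the narrow queries -/

/-- The slabs of the queries in `L` cover all solutions of `F` in the cube `[0,1]^ι`. -/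
def SlabCover {ι : Type} [Fintype ι] (F : Set (LinIneq ℤ ι)) (L : List (LinIneq ℤ ι)) : Prop :=
  ∀ x : ι → ℝ, (∀ i, 0 ≤ x i ∧ x i ≤ 1) → Satisfies x F → ∃ q ∈ L, q.InSlab x

/-- Setting the variables of a query with fewer than `w` variables removes that query and lowers
the index by less than `c * w`; this may make further queries narrow, but each round shortens the
list. -/
theorem SelfReducible.exists_wide_slabCover {𝓕 : UnsatFamily} {c : ℝ} (hc : 0 < c)
    (hself : SelfReducible 𝓕 c) (w : ℕ) :
    ∀ (t n : ℕ) (L : List (LinIneq ℤ (Fin (𝓕.ν n)))), L.length ≤ t → SlabCover (𝓕.F n) L →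
      c * w * t < n →
      ∃ (m : ℕ) (L' : List (LinIneq ℤ (Fin (𝓕.ν m)))), (n : ℝ) - c * w * t ≤ m ∧
        L'.length ≤ t ∧ SlabCover (𝓕.F m) L' ∧ ∀ q ∈ L', w ≤ q.support.card := by
  intro t
  induction t with
  | zero =>
    intro n L hL hcov _
    have : L = [] := List.eq_nil_of_length_eq_zero (Nat.le_zero.1 hL)
    subst this
    exact ⟨n, [], by simp, by simp, hcov, by simp⟩
  | succ t ih =>
    intro n L hL hcov hn
    push_cast at hn ⊢
    have hcw : 0 ≤ c * w := by positivity
    have hcwt : 0 ≤ c * w * t := by positivity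
    by_cases hwide : ∀ q ∈ L, w ≤ q.support.card
    · exact ⟨n, L, by nlinarith, hL, hcov, hwide⟩
    · push Not at hwide
      obtain ⟨q, hqL, hq⟩ := hwide
      have hqw : c * q.support.card ≤ c * w :=
        mul_le_mul_of_nonneg_left (by exact_mod_cast hq.le) hc.le
      obtain ⟨m, hm, ρ, hρ, e, he⟩ := hself n q.support (by
        rw [lt_div_iff₀ hc]
        nlinarith)
      obtain ⟨s, u, rfl⟩ := List.append_of_mem hqL
      have hcov' : SlabCover (𝓕.F m)
          ((s ++ u).map fun f => (f.restrict ρ).rename e) := by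
        intro x hx hxF
        obtain ⟨q', hq', hs⟩ := hcov _ (ρ.extend_mem_cube e hx) (he.satisfies_extend hx hxF)
        have hne : q' ≠ q := by
          rintro rfl
          exact LinIneq.not_inSlab_extend hρ e x hs
        refine ⟨_, List.mem_map_of_mem ?_, LinIneq.inSlab_rename_restrict hs⟩
        simpa [hne] using hq'
      obtain ⟨m', L', h₁, h₂, h₃, h₄⟩ := ih m _ (by simp at hL ⊢; omega) hcov' (by nlinarith)
      exact ⟨m', L', by nlinarith, by omega, h₃, h₄⟩

/-! ### The Littlewood–Offord bound -/

theorem sum_eq_sum_univ_ite {ι : Type} [Fintype ι] [DecidableEq ι] (f : ι → ℝ) (S : Finset ι) :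
    ∑ i ∈ S, f i = ∑ i, if i ∈ S then f i else 0 := by
  simp

/-- Write the sum over `S` as a constant plus the sum of `|d i|` over the symmetric difference of
`S` with the set where `d` is negative. Along a strict inclusion of symmetric differences it grows
by at least `δ`, so the sets counted here correspond to an antichain. -/
theorem card_sum_mem_Ico_le {ι : Type} [Fintype ι] [DecidableEq ι] (d : ι → ℝ) {δ : ℝ}
    (hd : ∀ i, δ ≤ |d i|) (u : ℝ) :
    #{S : Finset ι | u ≤ ∑ i ∈ S, d i ∧ ∑ i ∈ S, d i < u + δ} ≤
      (Fintype.card ι).choose (Fintype.card ι / 2) := by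
  set N : Finset ι := univ.filter fun i => d i < 0 with hN
  set A : Finset (Finset ι) := {S | u ≤ ∑ i ∈ S, d i ∧ ∑ i ∈ S, d i < u + δ} with hA
  have hsum (S : Finset ι) :
      ∑ i ∈ S, d i = ∑ i ∈ N, d i + ∑ i ∈ symmDiff S N, |d i| := by
    rw [sum_eq_sum_univ_ite d S, sum_eq_sum_univ_ite d N, sum_eq_sum_univ_ite (fun i => |d i|),
      ← sum_add_distrib]
    refine sum_congr rfl fun i _ => ?_
    by_cases hi : d i < 0
    · have hiN : i ∈ N := by simp [hN, hi]
      by_cases hiS : i ∈ S <;> simp [mem_symmDiff, hiN, hiS, abs_of_neg hi]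
    · have hiN : i ∉ N := by simp [hN, hi]
      by_cases hiS : i ∈ S <;> simp [mem_symmDiff, hiN, hiS, abs_of_nonneg (not_lt.1 hi)]
  have hinj : Function.Injective fun S : Finset ι => symmDiff S N :=
    symmDiff_left_injective N
  rw [← card_image_of_injective A hinj]
  refine IsAntichain.sperner ?_
  intro T hT T' hT' hne hle
  simp only [coe_image, Set.mem_image, mem_coe, hA, mem_filter, mem_univ, true_and] at hT hT'
  obtain ⟨S, ⟨hS₁, hS₂⟩, rfl⟩ := hT
  obtain ⟨S', ⟨hS₁', hS₂'⟩, rfl⟩ := hT'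
  obtain ⟨j, hj', hj⟩ := exists_of_ssubset (lt_of_le_of_ne hle hne)
  have hstep : ∑ i ∈ symmDiff S N, |d i| + |d j| ≤ ∑ i ∈ symmDiff S' N, |d i| := by
    rw [add_comm]
    refine (sum_insert hj (f := fun i => |d i|)).ge.trans ?_
    exact sum_le_sum_of_subset_of_nonneg (insert_subset hj' hle) fun i _ _ => abs_nonneg _
  have := hd j
  rw [hsum] at hS₁ hS₂'
  linarith

/-- The interval has length `1`, so `⌈δ⁻¹⌉₊` half-open intervals of length `δ` cover it. -/
theorem card_sum_mem_Ioo_le {ι : Type} [Fintype ι] [DecidableEq ι] (d : ι → ℝ) {δ : ℝ}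
    (hδ : 0 < δ) (hd : ∀ i, δ ≤ |d i|) (u : ℝ) :
    #{S : Finset ι | u - 1 < ∑ i ∈ S, d i ∧ ∑ i ∈ S, d i < u} ≤
      ⌈δ⁻¹⌉₊ * (Fintype.card ι).choose (Fintype.card ι / 2) := by
  have hsub : (univ.filter fun S : Finset ι => u - 1 < ∑ i ∈ S, d i ∧ ∑ i ∈ S, d i < u) ⊆
      (range ⌈δ⁻¹⌉₊).biUnion fun j => univ.filter fun S : Finset ι =>
        (u - 1 + j * δ) ≤ ∑ i ∈ S, d i ∧ ∑ i ∈ S, d i < (u - 1 + j * δ) + δ := by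
    intro S hS
    simp only [mem_filter, mem_univ, true_and, mem_biUnion, mem_range] at hS ⊢
    set v := ∑ i ∈ S, d i
    have hv : 0 ≤ (v - (u - 1)) / δ := div_nonneg (by linarith) hδ.le
    have h₁ := Nat.floor_le hv
    have h₂ := Nat.lt_floor_add_one ((v - (u - 1)) / δ)
    rw [le_div_iff₀ hδ] at h₁
    rw [div_lt_iff₀ hδ] at h₂
    refine ⟨⌊(v - (u - 1)) / δ⌋₊, ?_, by linarith, by linarith⟩
    rw [Nat.floor_lt hv]
    refine lt_of_lt_of_le ?_ (Nat.le_ceil _)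
    rw [div_lt_iff₀ hδ, inv_mul_cancel₀ hδ.ne']
    linarith
  refine (card_le_card hsub).trans (card_biUnion_le.trans ?_)
  refine (sum_le_card_nsmul _ _ _ fun j _ => card_sum_mem_Ico_le d hd _).trans ?_
  simp

/-! ### Words in a slab -/

theorem exists_perm_forall_ne {A : Type} [Fintype A] (h : 2 ≤ Fintype.card A) :
    ∃ σ : Equiv.Perm A, ∀ p, σ p ≠ p := by
  obtain ⟨k, hk⟩ := Nat.exists_eq_add_of_le' h
  let e : A ≃ Fin (k + 2) := Fintype.equivFinOfCardEq hk
  refine ⟨(e.trans (finRotate (k + 2))).trans e.symm, fun p hp => ?_⟩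
  simp [Equiv.symm_apply_eq] at hp

/-- Applying `σ` to the letters in the positions of `S` permutes the words, so the words in the slab
can be counted by averaging over `S ⊆ I`. For a fixed word `y`, letting `S` vary gives the subset
sums of the numbers `q.coeff i * (σ (y i) - y i)`, to which the Littlewood–Offord bound applies. -/
theorem LinIneq.card_inSlab_mul_le {ι A : Type} [Fintype ι] [DecidableEq ι] [Fintype A]
    (val : A → ℝ) (σ : Equiv.Perm A) {δ : ℝ} (hδ : 0 < δ)
    (hσ : ∀ p, δ ≤ |val (σ p) - val p|) (q : LinIneq ℤ ι) {I : Finset ι} (hI : I ⊆ q.support) :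
    {y : ι → A | q.InSlab fun i => val (y i)}.ncard * 2 ^ #I ≤
      Fintype.card A ^ Fintype.card ι * (⌈δ⁻¹⌉₊ * (#I).choose (#I / 2)) := by
  classical
  let sh (S : Finset I) : Equiv.Perm (ι → A) :=
    Equiv.piCongrRight fun i => if i ∈ S.map (Function.Embedding.subtype _) then σ else 1
  let r (S : Finset I) (y : ι → A) : Prop := q.InSlab fun i => val (sh S y i)
  have hleft (S : Finset I) : #{y | r S y} = {y : ι → A | q.InSlab fun i => val (y i)}.ncard := by
    rw [← Set.ncard_coe_finset, ← Set.ncard_image_of_injective _ (sh S).injective]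
    congr 1
    ext y
    simp only [coe_filter, mem_univ, true_and, Set.mem_image, Set.mem_ofPred_eq, r]
    constructor
    · rintro ⟨z, hz, rfl⟩
      exact hz
    · intro hy
      exact ⟨(sh S).symm y, by simpa using hy, by simp⟩
  have hright (y : ι → A) : #{S | r S y} ≤ ⌈δ⁻¹⌉₊ * (#I).choose (#I / 2) := by
    let d (i : I) : ℝ := q.coeff i * (val (σ (y i)) - val (y i))
    have hd (i : I) : δ ≤ |d i| := by
      have hne : q.coeff i ≠ 0 := by simpa [support] using hI i.2
      have h1 : (1 : ℝ) ≤ |(q.coeff i : ℝ)| := by exact_mod_cast Int.one_le_abs hne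
      rw [abs_mul]
      nlinarith [hσ (y i), abs_nonneg (val (σ (y i)) - val (y i))]
    have hs (S : Finset I) : ∑ i, (q.coeff i : ℝ) * val (sh S y i) =
        ∑ i, (q.coeff i : ℝ) * val (y i) + ∑ i ∈ S, d i := by
      have : ∑ i ∈ S, d i = ∑ i ∈ S.map (Function.Embedding.subtype _),
          (q.coeff i : ℝ) * (val (σ (y i)) - val (y i)) := by
        rw [sum_map]; rfl
      rw [this, sum_eq_sum_univ_ite _ (S.map _), ← sum_add_distrib]
      refine sum_congr rfl fun i _ => ?_
      simp only [sh, Equiv.piCongrRight_apply, Pi.map_apply]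
      split_ifs
      · ring
      · simp
    have h := card_sum_mem_Ioo_le d hδ hd (q.rhs - ∑ i, (q.coeff i : ℝ) * val (y i))
    rw [Fintype.card_coe] at h
    refine le_trans (card_le_card fun S hS => ?_) h
    simp only [r, InSlab, hs, mem_filter, mem_univ, true_and] at hS ⊢
    constructor <;> linarith [hS.1, hS.2]
  have hdouble := sum_card_bipartiteAbove_eq_sum_card_bipartiteBelow
    (s := (univ : Finset (Finset I))) (t := (univ : Finset (ι → A))) r
  simp only [bipartiteAbove, bipartiteBelow, hleft] at hdouble
  calc _ = ∑ y : ι → A, #{S | r S y} := by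
        rw [← hdouble]
        simp [mul_comm]
    _ ≤ ∑ _y : ι → A, ⌈δ⁻¹⌉₊ * (#I).choose (#I / 2) := sum_le_sum fun y _ => hright y
    _ = _ := by simp

theorem centralBinom_sq_mul_le (h : ℕ) : h.centralBinom ^ 2 * (2 * h + 1) ≤ 16 ^ h := by
  induction h with
  | zero => simp
  | succ h ih =>
    have hr := Nat.succ_mul_centralBinom_succ h
    have hp : 0 < (h + 1) ^ 2 := by positivity
    refine Nat.le_of_mul_le_mul_left ?_ hp
    calc (h + 1) ^ 2 * ((h + 1).centralBinom ^ 2 * (2 * (h + 1) + 1))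
        = ((h + 1) * (h + 1).centralBinom) ^ 2 * (2 * h + 3) := by ring
      _ = (4 * (2 * h + 1) * (2 * h + 3)) * (h.centralBinom ^ 2 * (2 * h + 1)) := by
          rw [hr]; ring
      _ ≤ (16 * (h + 1) ^ 2) * 16 ^ h := Nat.mul_le_mul (by nlinarith) ih
      _ = (h + 1) ^ 2 * 16 ^ (h + 1) := by ring

/-- Only `2 * h` of the variables of the query are needed. -/
theorem LinIneq.card_inSlab_le {ι A : Type} [Fintype ι] [DecidableEq ι] [Fintype A]
    (val : A → ℝ) (σ : Equiv.Perm A) {δ : ℝ} (hδ : 0 < δ)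
    (hσ : ∀ p, δ ≤ |val (σ p) - val p|) (q : LinIneq ℤ ι) {h : ℕ}
    (hq : 2 * h ≤ #q.support) :
    ({y : ι → A | q.InSlab fun i => val (y i)}.ncard : ℝ) * √(2 * h + 1) ≤
      ⌈δ⁻¹⌉₊ * (Fintype.card A : ℝ) ^ Fintype.card ι := by
  obtain ⟨I, hI, hIc⟩ := exists_subset_card_eq hq
  have h₁ := q.card_inSlab_mul_le val σ hδ hσ hI
  rw [hIc, Nat.mul_div_cancel_left h two_pos, pow_mul, ← Nat.centralBinom_eq_two_mul_choose] at h₁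
  have h₂ : (h.centralBinom : ℝ) * √(2 * h + 1) ≤ 4 ^ h := by
    refine abs_le_of_sq_le_sq' ?_ (by positivity) |>.2
    rw [mul_pow, Real.sq_sqrt (by positivity), ← pow_mul, mul_comm h 2, pow_mul]
    exact_mod_cast centralBinom_sq_mul_le h
  have h₁' : ({y : ι → A | q.InSlab fun i => val (y i)}.ncard : ℝ) * 4 ^ h ≤
      (Fintype.card A : ℝ) ^ Fintype.card ι * (⌈δ⁻¹⌉₊ * h.centralBinom) := by
    exact_mod_cast h₁
  have h4 : (0 : ℝ) < 4 ^ h := by positivity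
  refine le_of_mul_le_mul_right ?_ h4
  calc _ = ({y : ι → A | q.InSlab fun i => val (y i)}.ncard : ℝ) * 4 ^ h * √(2 * h + 1) := by
        ring
    _ ≤ (Fintype.card A : ℝ) ^ Fintype.card ι * (⌈δ⁻¹⌉₊ * h.centralBinom) * √(2 * h + 1) := by
        gcongr
    _ = ⌈δ⁻¹⌉₊ * (Fintype.card A : ℝ) ^ Fintype.card ι * (h.centralBinom * √(2 * h + 1)) := by
        ring
    _ ≤ _ := by gcongr

/-- Wide slabs that cover the solutions in the cube cover in particular the admissible words. -/
theorem SlabCover.card_admissible_le {ι : Type} [Fintype ι] [DecidableEq ι] {W : Finset ℚ}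
    (hW01 : ∀ q ∈ W, 0 ≤ q ∧ q ≤ 1) (σ : Equiv.Perm {q // q ∈ W}) {δ : ℝ} (hδ : 0 < δ)
    (hσ : ∀ p, δ ≤ |((σ p : ℚ) : ℝ) - ((p : ℚ) : ℝ)|) {F : Set (LinIneq ℤ ι)}
    {L : List (LinIneq ℤ ι)} (hcov : SlabCover F L) {h : ℕ}
    (hwide : ∀ q ∈ L, 2 * h ≤ #q.support) :
    ((admissible F W).ncard : ℝ) * √(2 * h + 1) ≤
      L.length * (⌈δ⁻¹⌉₊ * (#W : ℝ) ^ Fintype.card ι) := by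
  classical
  let val (p : {q // q ∈ W}) : ℝ := ((p : ℚ) : ℝ)
  let B (q : LinIneq ℤ ι) : Set (ι → {q // q ∈ W}) := {y | q.InSlab fun i => val (y i)}
  have hsub : admissible F W ⊆ ⋃ q ∈ L.toFinset, B q := by
    intro y hy
    obtain ⟨q, hq, hs⟩ := hcov (fun i => val (y i))
      (fun i => ⟨Rat.cast_nonneg.2 (hW01 _ (y i).2).1, by
        simpa [val] using (Rat.cast_le (K := ℝ)).2 (hW01 _ (y i).2).2⟩) hy
    simp only [Set.mem_iUnion]
    exact ⟨q, by simpa using hq, hs⟩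
  have h₁ : (admissible F W).ncard ≤ ∑ q ∈ L.toFinset, (B q).ncard :=
    (Set.ncard_le_ncard hsub (Set.toFinite _)).trans (Finset.set_ncard_biUnion_le _ _)
  calc ((admissible F W).ncard : ℝ) * √(2 * h + 1)
      ≤ (∑ q ∈ L.toFinset, (B q).ncard : ℕ) * √(2 * h + 1) := by gcongr
    _ = ∑ q ∈ L.toFinset, ((B q).ncard : ℝ) * √(2 * h + 1) := by
        rw [Nat.cast_sum, sum_mul]
    _ ≤ ∑ _q ∈ L.toFinset, ⌈δ⁻¹⌉₊ * (#W : ℝ) ^ Fintype.card ι := by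
        refine sum_le_sum fun q hq => ?_
        have := q.card_inSlab_le val σ hδ hσ (hwide q (by simpa using hq))
        rwa [Fintype.card_coe] at this
    _ = (#L.toFinset : ℝ) * (⌈δ⁻¹⌉₊ * (#W : ℝ) ^ Fintype.card ι) := by simp
    _ ≤ _ := by
        gcongr
        exact L.toFinset_card_le

theorem AlmostFull.eventually_le {𝓕 : UnsatFamily} {W : Finset ℚ} (h : AlmostFull 𝓕 W) :
    ∀ᶠ n in Filter.atTop, (#W : ℝ) ^ 𝓕.ν n / 2 ≤ ((admissible (𝓕.F n) W).ncard : ℝ) := by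
  filter_upwards [Asymptotics.IsLittleO.def h (by norm_num : (0 : ℝ) < 1 / 2)] with n hn
  rw [Real.norm_of_nonneg (by positivity : (0 : ℝ) ≤ (#W : ℝ) ^ 𝓕.ν n)] at hn
  have := (Real.le_norm_self _).trans hn
  linarith

end StabbingPlanes

theorem mainTheorem2
    (W : Finset ℚ) (hW01 : ∀ q ∈ W, 0 ≤ q ∧ q ≤ 1) (hW0 : (0 : ℚ) ∈ W) (hWcard : 2 ≤ W.card)
    (𝓕 : StabbingPlanes.UnsatFamily) (hfull : StabbingPlanes.AlmostFull 𝓕 W)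
    (c : ℝ) (hc : 0 < c) (hself : StabbingPlanes.SelfReducible 𝓕 c)
    (hfeas : ∀ᶠ n : ℕ in Filter.atTop,
      StabbingPlanes.Feasible (StabbingPlanes.LinIneq.toReal '' 𝓕.F n)) :
    ∃ C : ℝ, 0 < C ∧ ∃ N : ℕ, ∀ n : ℕ, N ≤ n →
      ∀ T : StabbingPlanes.SPTree (Fin (𝓕.ν n)), T.IsRefutation (𝓕.F n) →
        C * (n : ℝ) ^ (1 / 4 : ℝ) ≤ (T.length : ℝ) := by
  obtain ⟨σ, hσ⟩ := StabbingPlanes.exists_perm_forall_ne (A := {q // q ∈ W})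
    (by rwa [Fintype.card_coe])
  obtain ⟨δ, hδ, hσδ⟩ : ∃ δ : ℝ, 0 < δ ∧
      ∀ p, δ ≤ |((σ p : ℚ) : ℝ) - ((p : ℚ) : ℝ)| := by
    have : Nonempty {q // q ∈ W} := ⟨⟨0, hW0⟩⟩
    obtain ⟨p₀, hp₀⟩ := Finite.exists_min
      fun p : {q // q ∈ W} => |((σ p : ℚ) : ℝ) - ((p : ℚ) : ℝ)|
    refine ⟨_, abs_pos.2 (sub_ne_zero.2 fun h => hσ p₀ (Subtype.ext ?_)), hp₀⟩
    exact_mod_cast h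
  obtain ⟨M, hM⟩ := Filter.eventually_atTop.1 hfull.eventually_le
  set K : ℝ := (⌈δ⁻¹⌉₊ : ℝ) with hK
  have hKpos : 0 < K := by
    rw [hK]
    exact_mod_cast Nat.ceil_pos.2 (inv_pos.2 hδ)
  have hmin : 0 < min (1 / (4 * c)) (1 / (4 * K)) := lt_min (by positivity) (by positivity)
  refine ⟨min (1 / (4 * c)) (1 / (4 * K)), hmin, 2 * M + 1, fun n hn T hT => ?_⟩
  set C := min (1 / (4 * c)) (1 / (4 * K)) with hC
  by_contra! hlt
  have hCc : C * (4 * c) ≤ 1 := by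
    rw [← le_div_iff₀ (by positivity)]; exact min_le_left _ _
  have hCK : C * (4 * K) ≤ 1 := by
    rw [← le_div_iff₀ (by positivity)]; exact min_le_right _ _
  have hnpos : (0 : ℝ) < n := by exact_mod_cast (by omega : 0 < n)
  -- `r = n ^ (1 / 4)` and `h = ⌊√n⌋` satisfy `r * h ≤ n` and `r ≤ √(2 * h + 1)`.
  set r : ℝ := (n : ℝ) ^ (1 / 4 : ℝ) with hr
  have hr4 : r ^ 4 = n := by
    rw [hr, ← Real.rpow_natCast, ← Real.rpow_mul hnpos.le]; norm_num
  have hr1 : 1 ≤ r := Real.one_le_rpow (by exact_mod_cast (by omega : 1 ≤ n)) (by norm_num)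
  set h : ℕ := Nat.sqrt n with hh
  have hhr : (h : ℝ) ≤ r ^ 2 := by
    refine abs_le_of_sq_le_sq' ?_ (by positivity) |>.2
    rw [← pow_mul, hr4]
    exact_mod_cast Nat.sqrt_le' n
  have hrh : r ^ 2 ≤ 2 * h + 1 := by
    have h₁ : r ^ 2 ≤ h + 1 := by
      refine abs_le_of_sq_le_sq' ?_ (by positivity) |>.2
      rw [← pow_mul, hr4]
      exact_mod_cast (Nat.lt_succ_sqrt' n).le
    linarith [(Nat.cast_nonneg h : (0 : ℝ) ≤ h)]
  have hrs : r ≤ √(2 * h + 1) := Real.le_sqrt_of_sq_le hrh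
  have hsmall : c * ((2 * h : ℕ) : ℝ) * T.length ≤ n / 2 := by
    push_cast
    calc c * (2 * h) * T.length ≤ c * (2 * r ^ 2) * (C * r) := by gcongr
      _ = C * (4 * c) * r ^ 3 / 2 := by ring
      _ ≤ 1 * r ^ 4 / 2 := by
          gcongr
          · norm_num
      _ = n / 2 := by rw [hr4, one_mul]
  have hcov : StabbingPlanes.SlabCover (𝓕.F n) T.queries := fun x _ hx => T.exists_inSlab hT hx
  obtain ⟨m, L, hm, hL, hcovL, hwide⟩ :=
    hself.exists_wide_slabCover hc (2 * h) T.length n _ T.length_queries.le hcov (by linarith)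
  have hMm : M ≤ m := by
    have : (2 * M + 1 : ℝ) ≤ n := by exact_mod_cast hn
    have : (M : ℝ) ≤ m := by linarith
    exact_mod_cast this
  have hcount := hcovL.card_admissible_le hW01 σ hδ hσδ hwide
  have hhalf := hM m hMm
  rw [Fintype.card_fin] at hcount
  set P : ℝ := (W.card : ℝ) ^ 𝓕.ν m with hP
  have hPpos : 0 < P := pow_pos (by exact_mod_cast (by omega : 0 < W.card)) _
  have : P / 2 * r ≤ P / 4 * r := by
    calc P / 2 * r ≤ ((StabbingPlanes.admissible (𝓕.F m) W).ncard : ℝ) * √(2 * h + 1) := by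
          gcongr
      _ ≤ L.length * (K * P) := hcount
      _ ≤ C * r * (K * P) := by
          gcongr
          exact le_trans (by exact_mod_cast hL) hlt.le
      _ = C * (4 * K) * (P / 4 * r) := by ring
      _ ≤ 1 * (P / 4 * r) := by gcongr
      _ = P / 4 * r := one_mul _
  nlinarith [mul_pos hPpos (by linarith : 0 < r)]
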